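/- **Theorem.** Let $X_1$ and $X_2$ be finite simple connected graphs, each with at least two vertices, and let $\varepsilon_1\neq\varepsilon_2$ be edges of the Cartesian product $X_1\square X_2$. For a graph $Y$ let $\mathcal L(Y)$ be its line graph, with adjacency matrix $A_{\mathcal L(Y)}$. For a vertex $v$ of $\mathcal L(Y)$ (an edge of $Y$) let $\mathbf e_v$ be its characteristic vector, and let the eigenvalue support of $v$ be the set of real $\theta$ for which the orthogonal projection of $\mathbf e_v$ on the $\theta$-eigenspace of $A_{\mathcal L(Y)}$ is non-zero. Let $\Psi_{\varepsilon_1}$ be the eigenvalue support of $\varepsilon_1$ in $\mathcal L(X_1\square X_2)$, and for an edge $\{a,b\}$ of $X_1$ let $\Lambda_{ab}$ be its eigenvalue support in $\mathcal L(X_1)$. Adjacency perfect state transfer occurs between the vertices $\varepsilon_1$ and $\varepsilon_2$ of $\mathcal L(X_1\square X_2)$, that is, $$\exp\bigl(-\mathrm i\tau A_{\mathcal L(X_1\square X_2)}\bigr)\,\mathbf e_{\varepsilon_1}=\eta\,\mathbf e_{\varepsilon_2}\quad\text{for some } \tau>0 \text{ and some } \eta\in\mathbb C,\ |\eta|=1,$$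 if and only if, possibly after exchanging the roles of $X_1$ and $X_2$, the following conditions hold. 1. $X_2=K_2$, and $X_1$ either has a cut-edge or is a non-bipartite unicyclic graph (a connected graph with exactly one cycle). 2. There is an edge $\{a,b\}$ of $X_1$ with $-2\notin\Lambda_{ab}$ such that $\varepsilon_1=\{(a,1),(b,1)\}$ and $\varepsilon_2=\{(a,2),(b,2)\}$ for a suitable labelling $1,2$ of the two vertices of $X_2$. 3. $\Psi_{\varepsilon_1}\subset\mathbb Z$ and $\Lambda_{ab}\subset 4\mathbb Z$. -/

import Mathlib

/-- The adjacency transition matrix `U(t) = exp(-i t A)` of a finite graph. -/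
noncomputable def transitionMatrix {V : Type*} [Fintype V] (G : SimpleGraph V) (t : ℝ) :
    Matrix V V ℂ :=
  open Classical in
  NormedSpace.exp ((-(Complex.I * (t : ℂ))) • G.adjMatrix ℂ)

/-- Adjacency perfect state transfer from the vertex state `e_a` to the vertex state `e_b`:
`U(τ) e_a = η e_b` for some time `τ > 0` and some phase factor `η`. -/
def HasVertexPST {V : Type*} [Fintype V] (G : SimpleGraph V) (a b : V) : Prop :=
  open Classical in
  ∃ τ : ℝ, 0 < τ ∧ ∃ η : ℂ, ‖η‖ = 1 ∧
    (transitionMatrix G τ).mulVec (Pi.single a 1) = η • (Pi.single b 1 : V → ℂ)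

/-- The `θ`-eigenspace of the adjacency matrix of `G`. -/
noncomputable def adjEigenspace {V : Type*} [Fintype V] (G : SimpleGraph V) (θ : ℝ) :
    Submodule ℝ (EuclideanSpace ℝ V) :=
  open Classical in
  Module.End.eigenspace (Matrix.toEuclideanLin (G.adjMatrix ℝ)) θ

/-- The eigenvalue support of the vertex state `e_a` relative to the adjacency matrix of `G`:
all `θ` for which the orthogonal projection of `e_a` on the `θ`-eigenspace is non-zero. -/
def eigenvalueSupport {V : Type*} [Fintype V] (G : SimpleGraph V) (a : V) : Set ℝ :=
  open Classical in
  {θ | (adjEigenspace G θ).starProjection (EuclideanSpace.single a 1) ≠ 0}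

/-- `G` is a copy of the complete graph `K₂`. -/
def IsK2 {V : Type*} (G : SimpleGraph V) : Prop :=
  Nonempty (G ≃g (⊤ : SimpleGraph (Fin 2)))

/-- `G` has a cut-edge. -/
def HasCutEdge {V : Type*} (G : SimpleGraph V) : Prop :=
  ∃ e ∈ G.edgeSet, G.IsBridge e

/-- `G` is unicyclic: connected with exactly one cycle (cycles are identified with their
edge sets). -/
def IsUnicyclic {V : Type*} (G : SimpleGraph V) : Prop :=
  G.Connected ∧ ∃! s : Set (Sym2 V), ∃ (v : V) (p : G.Walk v v), p.IsCycle ∧ {e | e ∈ p.edges} = s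

/-- The conditions on the factors and on the two edges, where `Y` is the factor that has to be
`K₂`, and `copy e γ` is the copy of the edge `e` of `X` in the layer of `X □ Y` belonging to the
vertex `γ` of `Y`.  The graph `Z` stands for the Cartesian product of `X` and `Y`, taken in
either order. -/
def PSTConditions {V W T : Type*} [Fintype V] [Fintype T]
    (X : SimpleGraph V) (Y : SimpleGraph W) (Z : SimpleGraph T)
    [Fintype X.edgeSet] [Fintype Z.edgeSet]
    (copy : Sym2 V → W → Sym2 T) (ε₁ ε₂ : Z.edgeSet) : Prop :=
  IsK2 Y ∧ (HasCutEdge X ∨ (¬ X.IsBipartite ∧ IsUnicyclic X)) ∧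
  ∃ (e : X.edgeSet) (γ₁ γ₂ : W), γ₁ ≠ γ₂ ∧
    (ε₁ : Sym2 T) = copy e γ₁ ∧ (ε₂ : Sym2 T) = copy e γ₂ ∧
    (-2 : ℝ) ∉ eigenvalueSupport X.lineGraph e ∧
    (∀ θ ∈ eigenvalueSupport Z.lineGraph ε₁, ∃ k : ℤ, θ = k) ∧
    (∀ θ ∈ eigenvalueSupport X.lineGraph e, ∃ k : ℤ, θ = 4 * k)

/-! Let `N` be the vertex-edge incidence matrix of a graph. Then `NᵀN = A + 2` for its line graph
and `NNᵀ` is the signless Laplacian `Q`. Eigenvectors pass between the two, except at `-2`, where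
`Nζ = 0`; and `Q` of a Cartesian product is a Kronecker sum. State transfer means `exp(-iτθ) ζ(ε₁) =
η ζ(ε₂)` for every edge eigenfunction `ζ`, hence `|ζ(ε₁)| = |ζ(ε₂)|`.

Necessity. An edge of each factor spans a four-cycle, and signs alternating around it give an
eigenfunction for `-2`. So `ε₂` lies on every such four-cycle through `ε₁`. Products of eigenvectors
of `Q` rule out that they share a corner (`EdgeParallel.not_corner`). So they are opposite, and the
other factor has only two vertices (`EdgeParallel.exhaust`). Comparing phases at `θ`, `θ + 2` and
`-2` gives `η = -1` and `Λ_ab ⊂ 4ℤ` (`EdgePST.exists_eq_four_mul`). Since line graph eigenvalues are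
at least `-2`, the support is then non-negative, which makes `ab` a bridge
(`isBridge_of_edgeSupport_nonneg`); so the cut-edge alternative always holds.

Sufficiency. In a prism, sums and differences of the two layers of an eigenfunction are
eigenfunctions of `X` for `θ - 2` and `θ`. If `Λ_ab ⊂ 4ℤ`, then `τ = π/2` and `η = -1` work
(`edgePST_prism`). -/

namespace LineGraphPST

open Matrix

/-! ### State transfer and supports in terms of eigenvectors -/

theorem exp_smul_mulVec_of_eigen {n : Type*} [Fintype n] [DecidableEq n] (A : Matrix n n ℂ)
    (c θ : ℂ) (z : n → ℂ) (h : A *ᵥ z = θ • z) :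
    NormedSpace.exp (c • A) *ᵥ z = Complex.exp (c * θ) • z := by
  let _ : SeminormedRing (Matrix n n ℂ) := Matrix.linftyOpSemiNormedRing
  let _ : NormedRing (Matrix n n ℂ) := Matrix.linftyOpNormedRing
  let _ : NormedAlgebra ℂ (Matrix n n ℂ) := Matrix.linftyOpNormedAlgebra
  have hpow : ∀ k : ℕ, ((c • A) ^ k) *ᵥ z = (c * θ) ^ k • z := by
    intro k
    induction k with
    | zero => simp
    | succ k ih =>
      rw [pow_succ, ← mulVec_mulVec, smul_mulVec, h, mulVec_smul, mulVec_smul, ih]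
      simp only [smul_smul]
      congr 1
      ring
  have h1 := NormedSpace.exp_series_hasSum_exp' (𝕂 := ℂ) (c • A)
  have h2 := h1.mapL (LinearMap.toContinuousLinearMap
    ((Matrix.mulVecBilin ℂ ℂ).flip z : Matrix n n ℂ →ₗ[ℂ] (n → ℂ)))
  have h3 := (NormedSpace.exp_series_hasSum_exp' (𝕂 := ℂ) (c * θ)).smul_const z
  rw [← Complex.exp_eq_exp_ℂ] at h3
  have h4 : (fun k : ℕ => LinearMap.toContinuousLinearMap
      ((Matrix.mulVecBilin ℂ ℂ).flip z : Matrix n n ℂ →ₗ[ℂ] (n → ℂ))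
        ((k.factorial : ℂ)⁻¹ • (c • A) ^ k)) =
      fun k : ℕ => ((k.factorial : ℂ)⁻¹ • (c * θ) ^ k) • z := by
    funext k
    simp [hpow, smul_smul]
  rw [h4] at h2
  exact h2.unique h3

/-- `z` satisfies the eigenvector equation of the adjacency matrix of `G` for `θ`. -/
def IsAdjEig {V : Type*} [Fintype V] (G : SimpleGraph V) (θ : ℝ) (z : V → ℝ) : Prop :=
  open Classical in
  G.adjMatrix ℝ *ᵥ z = θ • z

-- The projection vanishes exactly when `e_a` is orthogonal to the eigenspace, and the inner product
-- with `z` is the coordinate `z a`.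
open Classical in
theorem mem_eigenvalueSupport_iff {V : Type*} [Fintype V] (G : SimpleGraph V) (a : V) (θ : ℝ) :
    θ ∈ eigenvalueSupport G a ↔ ∃ z : V → ℝ, IsAdjEig G θ z ∧ z a ≠ 0 := by
  have hmem : ∀ z : EuclideanSpace ℝ V, z ∈ adjEigenspace G θ ↔ IsAdjEig G θ z.ofLp := by
    intro z
    rw [adjEigenspace, Module.End.mem_eigenspace_iff, IsAdjEig]
    rw [← WithLp.ofLp_injective 2 |>.eq_iff]
    simp
  rw [eigenvalueSupport, Set.mem_ofPred_eq, ne_eq, Submodule.starProjection_apply_eq_zero_iff,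
    Submodule.mem_orthogonal]
  push Not
  constructor
  · rintro ⟨z, hz, h⟩
    exact ⟨z.ofLp, (hmem z).1 hz, by simpa [EuclideanSpace.inner_single_right] using h⟩
  · rintro ⟨z, hz, h⟩
    exact ⟨WithLp.toLp 2 z, (hmem _).2 hz, by simpa [EuclideanSpace.inner_single_right] using h⟩

open Classical in
/-- An orthonormal eigenbasis, in coordinates. -/
theorem exists_eigenbasis {n : Type*} [Fintype n] (A : Matrix n n ℝ) (hA : A.IsSymm) :
    ∃ (l : n → ℝ) (b : n → n → ℝ), (∀ i, A *ᵥ b i = l i • b i) ∧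
      ∀ a c, ∑ i, b i a * b i c = if a = c then 1 else 0 := by
  have hH : A.IsHermitian := by
    rw [Matrix.IsHermitian, Matrix.conjTranspose_eq_transpose_of_trivial]; exact hA
  refine ⟨hH.eigenvalues, fun i => (hH.eigenvectorBasis i).ofLp,
    fun i => hH.mulVec_eigenvectorBasis i, fun a c => ?_⟩
  have := hH.eigenvectorBasis.sum_inner_mul_inner
    (EuclideanSpace.single a (1 : ℝ)) (EuclideanSpace.single c (1 : ℝ))
  simpa [EuclideanSpace.inner_single_right, EuclideanSpace.inner_single_left, Pi.single_apply,
    eq_comm] using this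

theorem eq_zero_of_orthogonal_eigenvectors {n : Type*} [Fintype n] (A : Matrix n n ℝ)
    (hA : A.IsSymm) (x : n → ℝ)
    (h : ∀ (θ : ℝ) z, A *ᵥ z = θ • z → ∑ i, x i * z i = 0) : x = 0 := by
  classical
  obtain ⟨l, b, hb, ho⟩ := exists_eigenbasis A hA
  funext a
  have h1 : ∑ i, (∑ c, x c * b i c) * b i a = x a := by
    simp_rw [Finset.sum_mul]
    rw [Finset.sum_comm]
    simp_rw [mul_assoc, ← Finset.mul_sum, ho]
    simp
  rw [← h1]
  simp [h _ _ (hb _)]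

/-- A vector on which `A + 2` acts as inverse to a coordinate vector, provided that the
eigenvalues in the support of that coordinate are non-negative. -/
theorem exists_add_two_inverse {n : Type*} [Fintype n] [DecidableEq n] (A : Matrix n n ℝ)
    (hA : A.IsSymm) (a : n) (h : ∀ (θ : ℝ) z, A *ᵥ z = θ • z → z a ≠ 0 → 0 ≤ θ) :
    ∃ y : n → ℝ, A *ᵥ y + (2 : ℝ) • y = Pi.single a 1 ∧ y a ≤ 1 / 2 := by
  obtain ⟨l, b, hb, ho⟩ := exists_eigenbasis A hA
  have ho' : ∀ c d, ∑ i, b i c * b i d = if c = d then 1 else 0 := by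
    intro c d; convert ho c d
  -- The spectral expansion of `(A + 2)⁻¹ e_a`. A vanishing denominator is harmless, since it can
  -- occur only where `b i a = 0`.
  refine ⟨∑ i, (b i a / (l i + 2)) • b i, ?_, ?_⟩
  · rw [Matrix.mulVec_sum, Finset.smul_sum, ← Finset.sum_add_distrib]
    have : ∀ i, A *ᵥ ((b i a / (l i + 2)) • b i) + (2 : ℝ) • ((b i a / (l i + 2)) • b i) =
        b i a • b i := by
      intro i
      rw [mulVec_smul, hb, smul_smul, smul_smul, ← add_smul]
      by_cases h0 : b i a = 0
      · simp [h0]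
      · have := h _ _ (hb i) h0
        congr 1
        field_simp
    simp_rw [this]
    funext c
    simp [Finset.sum_apply, ho', Pi.single_apply, eq_comm]
  · have h1 : ∑ i, b i a * b i a = 1 := by simp [ho']
    rw [Finset.sum_apply]
    calc ∑ i, ((b i a / (l i + 2)) • b i) a ≤ ∑ i, (b i a * b i a) / 2 := by
          refine Finset.sum_le_sum fun i _ => ?_
          by_cases h0 : b i a = 0
          · simp [h0]
          · have := h _ _ (hb i) h0
            simp only [Pi.smul_apply, smul_eq_mul, div_mul_eq_mul_div]
            exact div_le_div_of_nonneg_left (mul_self_nonneg _) (by norm_num) (by linarith)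
      _ = 1 / 2 := by rw [← Finset.sum_div, h1]

-- The transition matrix is symmetric, so it can be moved onto a test vector; real eigenvectors of
-- the adjacency matrix suffice as test vectors because they span.
open Classical in
theorem hasVertexPST_iff {V : Type*} [Fintype V] (G : SimpleGraph V) (a b : V) :
    HasVertexPST G a b ↔ ∃ τ : ℝ, 0 < τ ∧ ∃ η : ℂ, ‖η‖ = 1 ∧
      ∀ θ z, IsAdjEig G θ z →
        Complex.exp (-(Complex.I * τ * θ)) * (z a : ℂ) = η * (z b : ℂ) := by
  unfold HasVertexPST
  refine exists_congr fun τ => and_congr_right fun _ => exists_congr fun η =>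
    and_congr_right fun _ => ?_
  set x : V → ℂ := (transitionMatrix G τ).mulVec (Pi.single a 1) - η • Pi.single b 1 with hx
  have hsymm : (transitionMatrix G τ)ᵀ = transitionMatrix G τ := by
    rw [transitionMatrix, ← Matrix.exp_transpose, transpose_smul, SimpleGraph.transpose_adjMatrix]
  have key : ∀ θ z, IsAdjEig G θ z → ∑ i, x i * (z i : ℂ) =
      Complex.exp (-(Complex.I * τ * θ)) * (z a : ℂ) - η * (z b : ℂ) := by
    intro θ z hz
    have hz' : G.adjMatrix ℂ *ᵥ (fun i => (z i : ℂ)) = (θ : ℂ) • (fun i => (z i : ℂ)) := by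
      funext i
      have := congrFun hz i
      simp only [SimpleGraph.adjMatrix_mulVec_apply, Pi.smul_apply, smul_eq_mul] at this ⊢
      exact_mod_cast this
    have hU : transitionMatrix G τ *ᵥ (fun i => (z i : ℂ)) =
        Complex.exp (-(Complex.I * τ * θ)) • (fun i => (z i : ℂ)) := by
      rw [transitionMatrix, exp_smul_mulVec_of_eigen _ _ _ _ hz', neg_mul]
    change x ⬝ᵥ (fun i => (z i : ℂ)) = _
    rw [hx, sub_dotProduct, smul_dotProduct, single_one_dotProduct, dotProduct_comm,
      dotProduct_mulVec, ← mulVec_transpose, hsymm, hU]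
    simp
  rw [← sub_eq_zero, ← hx]
  constructor
  · intro h θ z hz
    rw [← sub_eq_zero, ← key θ z hz, h]
    simp
  · intro h
    have hA : (G.adjMatrix ℝ).IsSymm := SimpleGraph.isSymm_adjMatrix G
    have h0 : ∀ (θ : ℝ) z, G.adjMatrix ℝ *ᵥ z = θ • z → ∑ i, x i * (z i : ℂ) = 0 := by
      intro θ z hz
      rw [key θ z hz, h θ z hz, sub_self]
    have hre := eq_zero_of_orthogonal_eigenvectors _ hA (fun i => (x i).re) (by
      intro θ z hz
      have := congrArg Complex.re (h0 θ z hz)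
      simpa using this)
    have him := eq_zero_of_orthogonal_eigenvectors _ hA (fun i => (x i).im) (by
      intro θ z hz
      have := congrArg Complex.im (h0 θ z hz)
      simpa using this)
    funext i
    exact Complex.ext (congrFun hre i) (congrFun him i)

/-! ### Integrality of eigenvalues -/

/-- The eigenvalues of an adjacency matrix are algebraic integers. -/
theorem IsAdjEig.isIntegral {V : Type*} [Fintype V] {G : SimpleGraph V} {θ : ℝ} {z : V → ℝ}
    (hz : IsAdjEig G θ z) (h0 : z ≠ 0) : IsIntegral ℤ θ := by
  classical
  have h1 : Module.End.HasEigenvalue (Matrix.toLin' (G.adjMatrix ℝ)) θ :=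
    Module.End.hasEigenvalue_of_hasEigenvector
      (x := z) ⟨Module.End.mem_eigenspace_iff.2 (by rw [toLin'_apply]; exact hz), h0⟩
  have h2 : (G.adjMatrix ℝ).charpoly.IsRoot θ := by
    rw [← Matrix.charpoly_toLin']
    exact (Module.End.hasEigenvalue_iff_isRoot_charpoly _ _).1 h1
  refine ⟨(G.adjMatrix ℤ).charpoly, Matrix.charpoly_monic _, ?_⟩
  rw [← Polynomial.eval_map, ← Matrix.charpoly_map]
  have : (G.adjMatrix ℤ).map (algebraMap ℤ ℝ) = G.adjMatrix ℝ := by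
    ext i j
    simp [SimpleGraph.adjMatrix_apply, apply_ite]
  rw [this]
  exact h2

/-- An algebraic integer that is an odd fraction of a multiple of four is a multiple of four. -/
theorem exists_eq_four_mul {θ : ℝ} (h : IsIntegral ℤ θ) {k m : ℤ}
    (hm : θ * (2 * m + 1) = 4 * k) : ∃ j : ℤ, θ = 4 * j := by
  have hm0 : (2 * (m : ℝ) + 1) ≠ 0 := by
    have : (2 * m + 1 : ℤ) ≠ 0 := by omega
    exact_mod_cast this
  have hq : θ = algebraMap ℚ ℝ ((4 * k : ℚ) / (2 * m + 1)) := by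
    simp only [eq_ratCast]
    push_cast
    rw [eq_div_iff hm0, hm]
  rw [hq, isIntegral_algebraMap_iff (algebraMap ℚ ℝ).injective] at h
  obtain ⟨j, hj⟩ := IsIntegrallyClosed.isIntegral_iff.1 h
  have hθ : θ = j := by rw [hq, ← hj]; simp
  have h3 : j * (2 * m + 1) = 4 * k := by
    rw [hθ] at hm
    exact_mod_cast hm
  have hd : (4 : ℤ) ∣ j := by
    have hc : IsCoprime (4 : ℤ) (2 * m + 1) := by
      have : IsCoprime (2 : ℤ) (2 * m + 1) := ⟨-m, 1, by ring⟩
      simpa using this.pow_left (m := 2)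
    exact hc.dvd_of_dvd_mul_right ⟨k, h3⟩
  obtain ⟨i, hi⟩ := hd
  exact ⟨i, by rw [hθ, hi]; push_cast; ring⟩

/-! ### Edge functions and the line graph -/

/-- The sum of an edge function over the edges at a vertex. -/
def vertexSum {V : Type*} [Fintype V] (ζ : Sym2 V → ℝ) (v : V) : ℝ := ∑ u, ζ s(v, u)

/-- `ζ` is an edge function of `G` that satisfies the eigenvector equation of the line graph of
`G` for `θ`. -/
structure IsEdgeEig {V : Type*} [Fintype V] (G : SimpleGraph V) (θ : ℝ) (ζ : Sym2 V → ℝ) :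
    Prop where
  supp : ∀ s, s ∉ G.edgeSet → ζ s = 0
  eig : ∀ a b, G.Adj a b → vertexSum ζ a + vertexSum ζ b = (θ + 2) * ζ s(a, b)

open Classical in
/-- Extension by zero of a function on the edges. -/
noncomputable def edgeExt {V : Type*} (G : SimpleGraph V) (z : G.edgeSet → ℝ) (s : Sym2 V) : ℝ :=
  if h : s ∈ G.edgeSet then z ⟨s, h⟩ else 0

@[simp]
theorem edgeExt_coe {V : Type*} (G : SimpleGraph V) (z : G.edgeSet → ℝ) (e : G.edgeSet) :
    edgeExt G z e = z e := by
  simp [edgeExt]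

theorem edgeExt_of_notMem {V : Type*} (G : SimpleGraph V) (z : G.edgeSet → ℝ) {s : Sym2 V}
    (h : s ∉ G.edgeSet) : edgeExt G z s = 0 := by
  simp only [edgeExt, h, dif_neg, not_false_eq_true]

theorem edgeExt_restrict {V : Type*} (G : SimpleGraph V) (ζ : Sym2 V → ℝ)
    (h : ∀ s, s ∉ G.edgeSet → ζ s = 0) : edgeExt G (fun e => ζ e) = ζ := by
  funext s
  by_cases hs : s ∈ G.edgeSet
  · simp [edgeExt, hs]
  · rw [edgeExt_of_notMem _ _ hs, h s hs]

open Classical in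
theorem vertexSum_edgeExt {V : Type*} [Fintype V] (G : SimpleGraph V) [Fintype G.edgeSet]
    (z : G.edgeSet → ℝ) (a : V) :
    vertexSum (edgeExt G z) a = ∑ e : G.edgeSet, if a ∈ (e : Sym2 V) then z e else 0 := by
  have h1 : ∀ u, edgeExt G z s(a, u) =
      ∑ e : G.edgeSet, if (e : Sym2 V) = s(a, u) then z e else 0 := by
    intro u
    by_cases h : s(a, u) ∈ G.edgeSet
    · rw [Finset.sum_eq_single (⟨s(a, u), h⟩ : G.edgeSet)]
      · simp only [edgeExt, h, dif_pos, if_true]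
      · intro e _ he
        rw [if_neg]
        exact fun h' => he (Subtype.ext h')
      · simp
    · rw [edgeExt_of_notMem _ _ h, Finset.sum_eq_zero]
      intro e _
      rw [if_neg]
      exact fun h' => h (h' ▸ e.2)
  simp_rw [vertexSum, h1]
  rw [Finset.sum_comm]
  refine Finset.sum_congr rfl fun e _ => ?_
  split_ifs with h
  · obtain ⟨u, hu⟩ := Sym2.mem_iff_exists.1 h
    simp only [hu, Sym2.congr_right, Finset.sum_ite_eq, Finset.mem_univ, if_true]
  · refine Finset.sum_eq_zero fun u _ => if_neg fun h' => h ?_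
    simp [h']

-- This is `A + 2 = NᵀN`: an edge is counted at both of its own ends, an adjacent edge at the one
-- common end.
open Classical in
theorem lineGraph_mulVec {V : Type*} [Fintype V] (G : SimpleGraph V) [Fintype G.edgeSet]
    (z : G.edgeSet → ℝ) {a b : V} (h : G.Adj a b) :
    (G.lineGraph.adjMatrix ℝ *ᵥ z) ⟨s(a, b), h⟩ + 2 * z ⟨s(a, b), h⟩ =
      vertexSum (edgeExt G z) a + vertexSum (edgeExt G z) b := by
  have hne := h.ne
  rw [vertexSum_edgeExt, vertexSum_edgeExt, ← Finset.sum_add_distrib]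
  have h2 : 2 * z ⟨s(a, b), h⟩ = ∑ e : G.edgeSet, if e = ⟨s(a, b), h⟩ then 2 * z e else 0 := by
    simp
  rw [h2, mulVec, dotProduct, ← Finset.sum_add_distrib]
  refine Finset.sum_congr rfl fun e _ => ?_
  rw [SimpleGraph.adjMatrix_apply]
  by_cases he : e = ⟨s(a, b), h⟩
  · subst he
    simp [two_mul]
  · have he' : (e : Sym2 V) ≠ s(a, b) := fun h' => he (Subtype.ext h')
    have hadj : G.lineGraph.Adj ⟨s(a, b), h⟩ e ↔ (a ∈ (e : Sym2 V) ∨ b ∈ (e : Sym2 V)) := by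
      rw [SimpleGraph.lineGraph_adj_iff_exists]
      simp [Ne.symm he]
    have hboth : ¬ (a ∈ (e : Sym2 V) ∧ b ∈ (e : Sym2 V)) := fun h' =>
      he' ((Sym2.mem_and_mem_iff hne).1 h')
    simp only [hadj, he, if_false]
    by_cases ha : a ∈ (e : Sym2 V) <;> by_cases hb : b ∈ (e : Sym2 V) <;> simp_all

theorem isAdjEig_lineGraph_iff {V : Type*} [Fintype V] (G : SimpleGraph V) [Fintype G.edgeSet]
    (θ : ℝ) (z : G.edgeSet → ℝ) :
    IsAdjEig G.lineGraph θ z ↔ IsEdgeEig G θ (edgeExt G z) := by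
  classical
  constructor
  · intro h
    refine ⟨fun s hs => edgeExt_of_notMem _ _ hs, fun a b hab => ?_⟩
    rw [← lineGraph_mulVec G z hab]
    have := congrFun h ⟨s(a, b), hab⟩
    have h2 := edgeExt_coe G z ⟨s(a, b), hab⟩
    simp only at h2
    simp only [Pi.smul_apply, smul_eq_mul] at this
    rw [h2, this]
    ring
  · intro h
    funext e
    obtain ⟨s, hs⟩ := e
    induction s using Sym2.ind with
    | _ a b =>
      have h1 := lineGraph_mulVec G z hs
      rw [h.eig a b hs] at h1
      have h2 := edgeExt_coe G z ⟨s(a, b), hs⟩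
      simp only at h2
      rw [h2] at h1
      simp only [Pi.smul_apply, smul_eq_mul]
      linarith

/-- Perfect state transfer between edges, in terms of edge eigenfunctions. -/
def EdgePST {V : Type*} [Fintype V] (G : SimpleGraph V) (s₁ s₂ : Sym2 V) : Prop :=
  ∃ τ : ℝ, 0 < τ ∧ ∃ η : ℂ, ‖η‖ = 1 ∧ ∀ θ ζ, IsEdgeEig G θ ζ →
    Complex.exp (-(Complex.I * τ * θ)) * (ζ s₁ : ℂ) = η * (ζ s₂ : ℂ)

/-- Eigenvalue support of an edge, in terms of edge eigenfunctions. -/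
def edgeSupport {V : Type*} [Fintype V] (G : SimpleGraph V) (s : Sym2 V) : Set ℝ :=
  {θ | ∃ ζ, IsEdgeEig G θ ζ ∧ ζ s ≠ 0}

theorem hasVertexPST_lineGraph_iff {V : Type*} [Fintype V] (G : SimpleGraph V)
    [Fintype G.edgeSet] (ε₁ ε₂ : G.edgeSet) :
    HasVertexPST G.lineGraph ε₁ ε₂ ↔ EdgePST G ε₁ ε₂ := by
  rw [hasVertexPST_iff, EdgePST]
  refine exists_congr fun τ => and_congr_right fun _ => exists_congr fun η =>
    and_congr_right fun _ => ⟨fun h θ ζ hζ => ?_, fun h θ z hz => ?_⟩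
  · refine h θ (fun e => ζ e) ?_
    rwa [isAdjEig_lineGraph_iff, edgeExt_restrict _ _ hζ.supp]
  · simpa using h θ _ ((isAdjEig_lineGraph_iff G θ z).1 hz)

theorem eigenvalueSupport_lineGraph {V : Type*} [Fintype V] (G : SimpleGraph V)
    [Fintype G.edgeSet] (ε : G.edgeSet) :
    eigenvalueSupport G.lineGraph ε = edgeSupport G ε := by
  ext θ
  rw [mem_eigenvalueSupport_iff]
  constructor
  · rintro ⟨z, hz, h0⟩
    exact ⟨_, (isAdjEig_lineGraph_iff G θ z).1 hz, by simpa using h0⟩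
  · rintro ⟨ζ, hζ, h0⟩
    exact ⟨fun e => ζ e, by rwa [isAdjEig_lineGraph_iff, edgeExt_restrict _ _ hζ.supp], h0⟩

theorem IsEdgeEig.comp_iso {V T : Type*} [Fintype V] [Fintype T] {G : SimpleGraph V}
    {Z : SimpleGraph T} (φ : G ≃g Z) {θ : ℝ} {ζ : Sym2 T → ℝ} (h : IsEdgeEig Z θ ζ) :
    IsEdgeEig G θ (fun s => ζ (s.map φ)) := by
  have hv : ∀ v, vertexSum (fun s => ζ (s.map φ)) v = vertexSum ζ (φ v) := by
    intro v
    simp only [vertexSum, Sym2.map_mk]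
    exact φ.toEquiv.sum_comp (fun u => ζ s(φ v, u))
  refine ⟨fun s hs => h.supp _ fun hs' => hs ?_, fun a b hab => ?_⟩
  · induction s using Sym2.ind with
    | _ a b => exact φ.map_adj_iff.1 hs'
  · rw [hv, hv, h.eig _ _ (φ.map_adj_iff.2 hab)]
    rfl

theorem EdgePST.map_iso {V T : Type*} [Fintype V] [Fintype T] {G : SimpleGraph V}
    {Z : SimpleGraph T} (φ : G ≃g Z) {s₁ s₂ : Sym2 V} (h : EdgePST G s₁ s₂) :
    EdgePST Z (s₁.map φ) (s₂.map φ) := by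
  obtain ⟨τ, h0, η, h1, h2⟩ := h
  exact ⟨τ, h0, η, h1, fun θ ζ hζ => h2 θ _ (hζ.comp_iso φ)⟩

theorem edgeSupport_map_subset {V T : Type*} [Fintype V] [Fintype T] {G : SimpleGraph V}
    {Z : SimpleGraph T} (φ : G ≃g Z) (s : Sym2 V) :
    edgeSupport Z (s.map φ) ⊆ edgeSupport G s := by
  rintro θ ⟨ζ, hζ, h0⟩
  exact ⟨_, hζ.comp_iso φ, h0⟩

/-- The edge eigenvalues are algebraic integers. -/
theorem isIntegral_of_mem_edgeSupport {V : Type*} [Fintype V] {G : SimpleGraph V} {s : Sym2 V}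
    {θ : ℝ} (h : θ ∈ edgeSupport G s) : IsIntegral ℤ θ := by
  classical
  obtain ⟨ζ, hζ, h0⟩ := h
  have h1 : IsAdjEig G.lineGraph θ (fun e => ζ e) := by
    rwa [isAdjEig_lineGraph_iff, edgeExt_restrict _ _ hζ.supp]
  refine h1.isIntegral fun h2 => h0 ?_
  by_cases hs : s ∈ G.edgeSet
  · exact congrFun h2 ⟨s, hs⟩
  · exact hζ.supp s hs

/-! ### Norm identity and the signless Laplacian -/

/-- Summation by parts for edge functions. -/
theorem sum_vertexSum_mul {V : Type*} [Fintype V] (ζ : Sym2 V → ℝ) :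
    ∑ v, vertexSum ζ v ^ 2 = (∑ v, ∑ u, (vertexSum ζ v + vertexSum ζ u) * ζ s(v, u)) / 2 := by
  have h1 : ∑ v, ∑ u, vertexSum ζ v * ζ s(v, u) = ∑ v, vertexSum ζ v ^ 2 := by
    refine Finset.sum_congr rfl fun v _ => ?_
    rw [← Finset.mul_sum, sq]
    rfl
  have h2 : ∑ v, ∑ u, vertexSum ζ u * ζ s(v, u) = ∑ v, vertexSum ζ v ^ 2 := by
    rw [Finset.sum_comm, ← h1]
    refine Finset.sum_congr rfl fun v _ => Finset.sum_congr rfl fun u _ => ?_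
    rw [Sym2.eq_swap]
  simp_rw [add_mul, Finset.sum_add_distrib, h1, h2]
  ring

/-- `‖Nζ‖² = ⟨NᵀNζ, ζ⟩ = (θ + 2)‖ζ‖²`; the double sum counts each edge twice, whence the division by
two. -/
theorem IsEdgeEig.sum_sq {V : Type*} [Fintype V] {G : SimpleGraph V} {θ : ℝ} {ζ : Sym2 V → ℝ}
    (h : IsEdgeEig G θ ζ) :
    ∑ v, vertexSum ζ v ^ 2 = (θ + 2) * (∑ v, ∑ u, ζ s(v, u) ^ 2) / 2 := by
  rw [sum_vertexSum_mul, Finset.mul_sum]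
  simp_rw [Finset.mul_sum]
  congr 1
  refine Finset.sum_congr rfl fun v _ => Finset.sum_congr rfl fun u _ => ?_
  by_cases hvu : G.Adj v u
  · rw [h.eig v u hvu]
    ring
  · rw [h.supp s(v, u) hvu]
    ring

theorem IsEdgeEig.vertexSum_eq_zero {V : Type*} [Fintype V] {G : SimpleGraph V}
    {ζ : Sym2 V → ℝ} (h : IsEdgeEig G (-2) ζ) (v : V) : vertexSum ζ v = 0 := by
  have h1 := h.sum_sq
  rw [show ((-2 : ℝ) + 2) = 0 by norm_num, zero_mul, zero_div,
    Finset.sum_eq_zero_iff_of_nonneg fun _ _ => sq_nonneg _] at h1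
  exact pow_eq_zero_iff two_ne_zero |>.1 (h1 v (Finset.mem_univ v))

theorem IsEdgeEig.neg_two_le {V : Type*} [Fintype V] {G : SimpleGraph V} {θ : ℝ}
    {ζ : Sym2 V → ℝ} (h : IsEdgeEig G θ ζ) {s : Sym2 V} (hs : ζ s ≠ 0) : -2 ≤ θ := by
  have h1 := h.sum_sq
  have h2 : 0 ≤ ∑ v, vertexSum ζ v ^ 2 := Finset.sum_nonneg fun _ _ => sq_nonneg _
  have h3 : 0 < ∑ v, ∑ u, ζ s(v, u) ^ 2 := by
    induction s using Sym2.ind with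
    | _ a b =>
      refine Finset.sum_pos' (fun v _ => Finset.sum_nonneg fun u _ => sq_nonneg _)
        ⟨a, Finset.mem_univ a, Finset.sum_pos' (fun u _ => sq_nonneg _)
          ⟨b, Finset.mem_univ b, by positivity⟩⟩
  by_contra hθ
  nlinarith

/-- `f` satisfies the eigenvector equation of the signless Laplacian of `G` for `μ`. -/
def IsSignlessEig {V : Type*} [Fintype V] (G : SimpleGraph V) (μ : ℝ) (f : V → ℝ) : Prop :=
  open Classical in
  ∀ v, (∑ u, if G.Adj v u then f v + f u else 0) = μ * f v

open Classical in
/-- The edge function adding up the values at the two ends. -/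
noncomputable def edgeOf {V : Type*} (G : SimpleGraph V) (f : V → ℝ) : Sym2 V → ℝ :=
  Sym2.lift ⟨fun a b => if G.Adj a b then f a + f b else 0, fun a b => by
    simp only [add_comm, G.adj_comm]⟩

theorem edgeOf_of_adj {V : Type*} {G : SimpleGraph V} (f : V → ℝ) {a b : V} (h : G.Adj a b) :
    edgeOf G f s(a, b) = f a + f b := by
  simp [edgeOf, h]

/-- If `NNᵀf = μf`, then `NᵀN(Nᵀf) = μNᵀf`; here `edgeOf` is `Nᵀ`. -/
theorem IsSignlessEig.isEdgeEig {V : Type*} [Fintype V] {G : SimpleGraph V} {μ : ℝ} {f : V → ℝ}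
    (h : IsSignlessEig G μ f) : IsEdgeEig G (μ - 2) (edgeOf G f) := by
  have hv : ∀ v, vertexSum (edgeOf G f) v = μ * f v := by
    intro v
    rw [← h v]
    rfl
  refine ⟨fun s hs => ?_, fun a b hab => ?_⟩
  · induction s using Sym2.ind with
    | _ a b => exact if_neg hs
  · rw [hv, hv, edgeOf_of_adj f hab]
    ring

theorem IsEdgeEig.isSignlessEig {V : Type*} [Fintype V] {G : SimpleGraph V} {θ : ℝ}
    {ζ : Sym2 V → ℝ} (h : IsEdgeEig G θ ζ) : IsSignlessEig G (θ + 2) (vertexSum ζ) := by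
  classical
  intro v
  rw [vertexSum, Finset.mul_sum]
  refine Finset.sum_congr rfl fun u _ => ?_
  split_ifs with hvu
  · exact h.eig v u hvu
  · rw [h.supp s(v, u) hvu, mul_zero]

theorem IsSignlessEig.nonneg {V : Type*} [Fintype V] {G : SimpleGraph V} {μ : ℝ} {f : V → ℝ}
    (h : IsSignlessEig G μ f) {v : V} (hv : f v ≠ 0) : 0 ≤ μ := by
  by_cases h0 : ∃ s, edgeOf G f s ≠ 0
  · obtain ⟨s, hs⟩ := h0
    linarith [h.isEdgeEig.neg_two_le hs]
  · push Not at h0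
    have h1 := h v
    have h2 : vertexSum (edgeOf G f) v = 0 := Finset.sum_eq_zero fun u _ => h0 _
    have h3 : μ * f v = 0 := by rw [← h1]; exact h2
    rcases mul_eq_zero.1 h3 with h4 | h4
    · exact h4.ge
    · exact absurd h4 hv

open Classical in
/-- The eigenvectors of the signless Laplacian meeting a non-isolated vertex do not all belong to
one eigenvalue. -/
theorem exists_isSignlessEig_ne {V : Type*} [Fintype V] {G : SimpleGraph V} {a b : V}
    (hab : G.Adj a b) (α : ℝ) : ∃ μ f, IsSignlessEig G μ f ∧ f a ≠ 0 ∧ μ ≠ α := by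
  set M : Matrix V V ℝ := diagonal (fun v => (G.degree v : ℝ)) + G.adjMatrix ℝ with hM
  have hS : M.IsSymm := by
    rw [IsSymm, hM, transpose_add, diagonal_transpose, SimpleGraph.transpose_adjMatrix]
  have hmul : ∀ (f : V → ℝ) v, (M *ᵥ f) v = ∑ u, if G.Adj v u then f v + f u else 0 := by
    intro f v
    have h1 : ∑ u, (if G.Adj v u then f v + f u else 0) =
        ∑ u ∈ G.neighborFinset v, (f v + f u) := by
      rw [← Finset.sum_filter, SimpleGraph.neighborFinset_eq_filter]
    rw [h1, hM, add_mulVec, Pi.add_apply, mulVec_diagonal, SimpleGraph.adjMatrix_mulVec_apply,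
      Finset.sum_add_distrib, Finset.sum_const, SimpleGraph.card_neighborFinset_eq_degree,
      nsmul_eq_mul]
  by_contra! hcon
  -- Otherwise `(M - α)e_a` would be orthogonal to all eigenvectors, yet its entry at the neighbour
  -- `b` is 1.
  have h0 := eq_zero_of_orthogonal_eigenvectors M hS (fun u => M a u - α * (1 : Matrix V V ℝ) a u)
    (by
      intro θ z hz
      have h1 : (M *ᵥ z) a = θ * z a := congrFun hz a
      have h2 : IsSignlessEig G θ z := fun v => by rw [← hmul]; exact congrFun hz v
      have h3 : ((1 : Matrix V V ℝ) *ᵥ z) a = z a := by rw [one_mulVec]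
      have h4 : ∑ u, (M a u - α * (1 : Matrix V V ℝ) a u) * z u = (θ - α) * z a := by
        simp_rw [sub_mul, Finset.sum_sub_distrib, mul_assoc, ← Finset.mul_sum]
        rw [← h1]
        exact congrArg (fun t => (M *ᵥ z) a - α * t) h3
      rw [h4]
      by_cases hza : z a = 0
      · rw [hza, mul_zero]
      · rw [hcon θ z h2 hza, sub_self, zero_mul])
  have h1 := congrFun h0 b
  simp [hM, hab, hab.ne] at h1

/-! ### Non-negative support forces a bridge -/

/-- An edge of a connected graph whose line graph eigenvalue support is non-negative is a
bridge. -/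
theorem isBridge_of_edgeSupport_nonneg {V : Type*} [Fintype V] {G : SimpleGraph V}
    (hG : G.Connected) {a b : V} (hab : G.Adj a b)
    (h : ∀ θ ∈ edgeSupport G s(a, b), 0 ≤ θ) : G.IsBridge s(a, b) := by
  classical
  by_contra hbr
  have hconn : (G.deleteEdges {s(a, b)}).Connected := hG.connected_delete_edge_of_not_isBridge hbr
  -- With `y = (A + 2)⁻¹ e_ab`, the vertex sums `n = Ny` satisfy `Nᵀn = e_ab`.
  obtain ⟨y, hy, hya⟩ := exists_add_two_inverse (G.lineGraph.adjMatrix ℝ)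
    (SimpleGraph.isSymm_adjMatrix _) ⟨s(a, b), hab⟩ (by
      intro θ z hz h0
      exact h θ ⟨edgeExt G z, (isAdjEig_lineGraph_iff G θ z).1 hz, by
        have := edgeExt_coe G z ⟨s(a, b), hab⟩
        simp only at this
        rwa [this]⟩)
  set ζ := edgeExt G y with hζ
  set n := vertexSum ζ with hn
  have hζab : ζ s(a, b) = y ⟨s(a, b), hab⟩ := edgeExt_coe G y ⟨s(a, b), hab⟩
  have hedge : ∀ c d, G.Adj c d → n c + n d = if s(c, d) = s(a, b) then 1 else 0 := by
    intro c d hcd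
    rw [hn, hζ, ← lineGraph_mulVec G y hcd]
    have := congrFun hy ⟨s(c, d), hcd⟩
    simp only [Pi.add_apply, Pi.smul_apply, smul_eq_mul] at this
    rw [this, Pi.single_apply]
    exact if_congr Subtype.ext_iff rfl rfl
  have hne := hab.ne
  -- `‖Ny‖² = ⟨(A + 2)y, y⟩ = y(ab)`.
  have hsum : ∑ v, n v ^ 2 ≤ 1 / 2 := by
    have h1 : ∑ v, n v ^ 2 = ζ s(a, b) := by
      rw [hn, sum_vertexSum_mul, ← hn]
      have h2 : ∀ v u, (n v + n u) * ζ s(v, u) =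
          (if v = a then if u = b then ζ s(a, b) else 0 else 0) +
          (if v = b then if u = a then ζ s(a, b) else 0 else 0) := by
        intro v u
        by_cases hvu : G.Adj v u
        · rw [hedge v u hvu]
          by_cases h1 : v = a ∧ u = b
          · obtain ⟨rfl, rfl⟩ := h1
            simp [hne]
          · by_cases h2 : v = b ∧ u = a
            · obtain ⟨rfl, rfl⟩ := h2
              simp [hne.symm, Sym2.eq_swap (a := v) (b := u)]
            · rw [if_neg (by rw [Sym2.eq_iff]; tauto), zero_mul]
              split_ifs <;> simp_all
        · rw [show ζ s(v, u) = 0 from edgeExt_of_notMem _ _ hvu, mul_zero]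
          by_cases h1 : v = a ∧ u = b
          · obtain ⟨rfl, rfl⟩ := h1
            exact absurd hab hvu
          · by_cases h2 : v = b ∧ u = a
            · obtain ⟨rfl, rfl⟩ := h2
              exact absurd hab.symm hvu
            · split_ifs <;> simp_all
      simp_rw [h2, Finset.sum_add_distrib]
      simp
    rw [h1, hζab]
    exact hya
  -- `n` changes sign along every edge other than `ab`, and such edges connect the graph. With `n a
  -- + n b = 1` each `n v ^ 2` is `1/4`, so there are at most two vertices, while a detour from `a`
  -- to `b` needs a third.
  have hsq : ∀ c d, n c ^ 2 = n d ^ 2 := by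
    intro c d
    obtain ⟨p⟩ := hconn.preconnected c d
    induction p with
    | nil => rfl
    | cons hadj _ ih =>
      rw [← ih]
      rw [SimpleGraph.deleteEdges_adj] at hadj
      have := hedge _ _ hadj.1
      rw [if_neg (by simpa using hadj.2)] at this
      rw [eq_neg_of_add_eq_zero_left this, neg_sq]
  have hab1 : n a + n b = 1 := by rw [hedge a b hab, if_pos rfl]
  have hna : n a ^ 2 = 1 / 4 := by
    have := hsq a b
    have h2 : n b = 1 - n a := by linarith
    rw [h2] at this
    have h3 : n a = 1 / 2 := by nlinarith
    rw [h3]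
    norm_num
  have hcard : (Fintype.card V : ℝ) ≤ 2 := by
    simp_rw [fun v => (hsq v a).trans hna, Finset.sum_const, nsmul_eq_mul] at hsum
    rw [Finset.card_univ] at hsum
    linarith
  have hcard' : Fintype.card V ≤ 2 := by exact_mod_cast hcard
  obtain ⟨p⟩ := hconn.preconnected a b
  cases p with
  | nil => exact hne rfl
  | @cons _ c _ hadj _ =>
    rw [SimpleGraph.deleteEdges_adj] at hadj
    have hcb : c ≠ b := by
      rintro rfl
      exact hadj.2 rfl
    have h3 : ({a, b, c} : Finset V).card = 3 :=
      Finset.card_eq_three.2 ⟨a, b, c, hne, hadj.1.ne, hcb.symm, rfl⟩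
    have := Finset.card_le_univ ({a, b, c} : Finset V)
    omega

/-! ### Eigenfunctions on Cartesian products -/

theorem sum_boxProd {V W : Type*} [Fintype V] [Fintype W] (X : SimpleGraph V)
    (Y : SimpleGraph W) (a : V) (γ : W) (F : V × W → ℝ)
    (h : ∀ p, ¬ (X.boxProd Y).Adj (a, γ) p → F p = 0) :
    ∑ p, F p = ∑ c, F (c, γ) + ∑ δ, F (a, δ) := by
  classical
  have h1 : ∀ c δ, F (c, δ) = (if δ = γ then F (c, γ) else 0) + if c = a then F (a, δ) else 0 := by
    intro c δ
    -- The point `(a, γ)` occurs in both sums on the right, but there are no loops.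
    have h0 : F (a, γ) = 0 := h _ (SimpleGraph.irrefl _)
    by_cases h2 : δ = γ <;> by_cases h3 : c = a
    · rw [h2, h3, if_pos rfl, if_pos rfl, h0, add_zero]
    · simp [h2, h3]
    · simp [h2, h3]
    · rw [if_neg h2, if_neg h3, add_zero]
      exact h _ (by simp [SimpleGraph.boxProd_adj, Ne.symm h2, Ne.symm h3])
  rw [Fintype.sum_prod_type,
    Finset.sum_congr rfl fun c _ => Finset.sum_congr rfl fun δ _ => h1 c δ]
  simp only [Finset.sum_add_distrib, Finset.sum_ite_eq', Finset.mem_univ, if_true]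
  congr 1
  rw [Finset.sum_comm]
  simp

theorem vertexSum_boxProd {V W : Type*} [Fintype V] [Fintype W] {X : SimpleGraph V}
    {Y : SimpleGraph W} {ζ : Sym2 (V × W) → ℝ} (h : ∀ s, s ∉ (X.boxProd Y).edgeSet → ζ s = 0)
    (a : V) (γ : W) :
    vertexSum ζ (a, γ) = ∑ c, ζ s((a, γ), (c, γ)) + ∑ δ, ζ s((a, γ), (a, δ)) :=
  sum_boxProd X Y a γ (fun p => ζ s((a, γ), p)) fun p hp => h s((a, γ), p) hp

theorem IsSignlessEig.boxProd {V W : Type*} [Fintype V] [Fintype W] {X : SimpleGraph V}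
    {Y : SimpleGraph W} {α β : ℝ} {f : V → ℝ} {g : W → ℝ} (hf : IsSignlessEig X α f)
    (hg : IsSignlessEig Y β g) :
    IsSignlessEig (X.boxProd Y) (α + β) (fun p => f p.1 * g p.2) := by
  classical
  rintro ⟨a, γ⟩
  rw [sum_boxProd X Y a γ _ fun p hp => if_neg hp]
  simp only [SimpleGraph.boxProd_adj_left, SimpleGraph.boxProd_adj_right, ← add_mul, ← mul_add]
  have h1 : ∀ c, (if X.Adj a c then (f a + f c) * g γ else 0) =
      (if X.Adj a c then f a + f c else 0) * g γ := by
    intro c; split_ifs <;> simp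
  have h2 : ∀ δ, (if Y.Adj γ δ then f a * (g γ + g δ) else 0) =
      f a * (if Y.Adj γ δ then g γ + g δ else 0) := by
    intro c; split_ifs <;> simp
  simp_rw [h1, h2, ← Finset.sum_mul, ← Finset.mul_sum]
  have h3 := hf a
  have h4 := hg γ
  rw [h3, h4]
  ring

open Classical in
/-- The indicator function of an edge. -/
noncomputable def edgeIndicator {V : Type*} (e s : Sym2 V) : ℝ := if s = e then 1 else 0

open Classical in
theorem vertexSum_edgeIndicator {V : Type*} [Fintype V] {p q : V} (h : p ≠ q) (v : V) :
    vertexSum (edgeIndicator s(p, q)) v = (if v = p then 1 else 0) + if v = q then 1 else 0 := by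
  simp only [vertexSum, edgeIndicator]
  by_cases h1 : v = p
  · subst h1
    simp [h]
  · by_cases h2 : v = q
    · subst h2
      simp [h.symm, Sym2.eq_swap (a := p)]
    · simp [h1, h2]

/-- The alternating edge function on the four-cycle of two edges of the factors. -/
noncomputable def fourCycle {V W : Type*} (a b : V) (γ δ : W) (s : Sym2 (V × W)) : ℝ :=
  edgeIndicator s((a, γ), (b, γ)) s + edgeIndicator s((a, δ), (b, δ)) s -
    edgeIndicator s((a, γ), (a, δ)) s - edgeIndicator s((b, γ), (b, δ)) s

/-- Each vertex of the four-cycle meets one edge of either sign, so all vertex sums vanish. -/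
theorem isEdgeEig_fourCycle {V W : Type*} [Fintype V] [Fintype W] {X : SimpleGraph V}
    {Y : SimpleGraph W} {a b : V} {γ δ : W} (hab : X.Adj a b) (hγδ : Y.Adj γ δ) :
    IsEdgeEig (X.boxProd Y) (-2) (fourCycle a b γ δ) := by
  classical
  have h0 : ∀ v, vertexSum (fourCycle a b γ δ) v = 0 := by
    intro v
    have h1 := vertexSum_edgeIndicator (p := (a, γ)) (q := (b, γ)) (by simp [hab.ne]) v
    have h2 := vertexSum_edgeIndicator (p := (a, δ)) (q := (b, δ)) (by simp [hab.ne]) v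
    have h3 := vertexSum_edgeIndicator (p := (a, γ)) (q := (a, δ)) (by simp [hγδ.ne]) v
    have h4 := vertexSum_edgeIndicator (p := (b, γ)) (q := (b, δ)) (by simp [hγδ.ne]) v
    simp only [vertexSum, fourCycle, Finset.sum_add_distrib, Finset.sum_sub_distrib] at *
    rw [h1, h2, h3, h4]
    ring
  refine ⟨fun s hs => ?_, fun p q _ => by rw [h0, h0]; ring⟩
  have hs1 : s ≠ s((a, γ), (b, γ)) := by rintro rfl; exact hs (by simp [hab])
  have hs2 : s ≠ s((a, δ), (b, δ)) := by rintro rfl; exact hs (by simp [hab])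
  have hs3 : s ≠ s((a, γ), (a, δ)) := by rintro rfl; exact hs (by simp [hγδ])
  have hs4 : s ≠ s((b, γ), (b, δ)) := by rintro rfl; exact hs (by simp [hγδ])
  simp [fourCycle, edgeIndicator, hs1, hs2, hs3, hs4]

theorem fourCycle_left {V W : Type*} {a b : V} {γ δ : W} (hab : a ≠ b) (hγδ : γ ≠ δ) :
    fourCycle a b γ δ s((a, γ), (b, γ)) = 1 := by
  simp [fourCycle, edgeIndicator, hab, hab.symm, hγδ]

theorem fourCycle_right {V W : Type*} {a b : V} {γ δ : W} (hab : a ≠ b) (hγδ : γ ≠ δ) :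
    fourCycle a b γ δ s((a, γ), (a, δ)) = -1 := by
  simp [fourCycle, edgeIndicator, hab, hγδ, hγδ.symm]

/-! ### Necessity: locating the second edge and the phases -/

/-- All edge eigenfunctions have the same absolute value at the two edges. -/
def EdgeParallel {V : Type*} [Fintype V] (G : SimpleGraph V) (s₁ s₂ : Sym2 V) : Prop :=
  ∀ θ ζ, IsEdgeEig G θ ζ → |ζ s₁| = |ζ s₂|

theorem EdgeParallel.symm {V : Type*} [Fintype V] {G : SimpleGraph V} {s₁ s₂ : Sym2 V}
    (h : EdgeParallel G s₁ s₂) : EdgeParallel G s₂ s₁ := fun θ ζ hζ => (h θ ζ hζ).symm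

theorem EdgePST.edgeParallel {V : Type*} [Fintype V] {G : SimpleGraph V} {s₁ s₂ : Sym2 V}
    (h : EdgePST G s₁ s₂) : EdgeParallel G s₁ s₂ := by
  obtain ⟨τ, _, η, hη, h⟩ := h
  intro θ ζ hζ
  have h1 := congrArg norm (h θ ζ hζ)
  rw [norm_mul, norm_mul, hη, one_mul, Complex.norm_exp] at h1
  simpa using h1

section FourCycle

variable {V W : Type*} [Fintype V] [Fintype W] {X : SimpleGraph V} {Y : SimpleGraph W}
  {s₁ s₂ : Sym2 (V × W)} {a b : V} {γ δ : W}

theorem EdgeParallel.mem_fourCycle (h : EdgeParallel (X.boxProd Y) s₁ s₂)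
    (hab : X.Adj a b) (hγδ : Y.Adj γ δ) (h0 : fourCycle a b γ δ s₁ ≠ 0) :
    s₂ = s((a, γ), (b, γ)) ∨ s₂ = s((a, δ), (b, δ)) ∨
      s₂ = s((a, γ), (a, δ)) ∨ s₂ = s((b, γ), (b, δ)) := by
  by_contra! hcon
  have h1 := h _ _ (isEdgeEig_fourCycle hab hγδ)
  obtain ⟨h2, h3, h4, h5⟩ := hcon
  have h6 : fourCycle a b γ δ s₂ = 0 := by simp [fourCycle, edgeIndicator, h2, h3, h4, h5]
  rw [h6, abs_zero, abs_eq_zero] at h1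
  exact h0 h1

theorem EdgeParallel.cases (h : EdgeParallel (X.boxProd Y) s((a, γ), (b, γ)) s₂)
    (hne : s((a, γ), (b, γ)) ≠ s₂) (hab : X.Adj a b) (hγδ : Y.Adj γ δ) :
    s₂ = s((a, δ), (b, δ)) ∨ s₂ = s((a, γ), (a, δ)) ∨ s₂ = s((b, γ), (b, δ)) := by
  rcases h.mem_fourCycle hab hγδ (by rw [fourCycle_left hab.ne hγδ.ne]; exact one_ne_zero) with
    h1 | h1
  · exact absurd h1.symm hne
  · exact h1

/-- The four-cycles belonging to two different neighbours of `γ` share only the first edge, but `s₂`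
lies on both. -/
theorem EdgeParallel.eq_of_adj (h : EdgeParallel (X.boxProd Y) s((a, γ), (b, γ)) s₂)
    (hne : s((a, γ), (b, γ)) ≠ s₂) (hab : X.Adj a b) (hγδ : Y.Adj γ δ) {δ' : W}
    (hδ' : Y.Adj γ δ') : δ' = δ := by
  have h1 := h.cases hne hab hγδ
  have h2 := h.cases hne hab hδ'
  have := hγδ.ne
  have := hδ'.ne
  have := hab.ne
  rcases h1 with rfl | rfl | rfl <;> simp at h2 <;> grind

/-- Four-cycles through either edge show that `a` and `γ` have degree one. Hence a product `f ⊗ g`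
of signless eigenvectors for `α` and `β` induces the values `α f(a) g(γ)` and `β f(a) g(γ)` on the
two edges. This forces `α = β` whenever `f(a)` and `g(γ)` are non-zero, although more than one `α`
occurs at `a`. -/
theorem EdgeParallel.not_corner (h : EdgeParallel (X.boxProd Y) s((a, γ), (b, γ))
      s((a, γ), (a, δ))) (hab : X.Adj a b) (hγδ : Y.Adj γ δ) : False := by
  classical
  have habn := hab.ne
  have hγδn := hγδ.ne
  have hγ : ∀ δ', Y.Adj γ δ' → δ' = δ := fun δ' hδ' =>
    h.eq_of_adj (by simp [habn.symm]) hab hγδ hδ'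
  have ha : ∀ b', X.Adj a b' → b' = b := by
    intro b' hb'
    have h1 := h.symm.mem_fourCycle hb' hγδ (by
      rw [fourCycle_right hb'.ne hγδn]; norm_num)
    have := hb'.ne
    simp at h1
    grind
  -- The value 0 is arbitrary: any eigenvector with `g γ ≠ 0` will do.
  obtain ⟨β, g, hg, hgγ, -⟩ := exists_isSignlessEig_ne hγδ 0
  obtain ⟨α, f, hf, hfa, hne⟩ := exists_isSignlessEig_ne hab β
  have hf1 : f a + f b = α * f a := by
    rw [← hf a, Finset.sum_eq_single b]
    · simp [hab]
    · intro u _ hu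
      exact if_neg fun hu' => hu (ha u hu')
    · simp
  have hg1 : g γ + g δ = β * g γ := by
    rw [← hg γ, Finset.sum_eq_single δ]
    · simp [hγδ]
    · intro u _ hu
      exact if_neg fun hu' => hu (hγ u hu')
    · simp
  have h1 := h _ _ (hf.boxProd hg).isEdgeEig
  rw [edgeOf_of_adj _ (by simpa using hab), edgeOf_of_adj _ (by simpa using hγδ)] at h1
  simp only [← add_mul, ← mul_add, hf1, hg1, abs_mul, abs_of_nonneg (hf.nonneg hfa),
    abs_of_nonneg (hg.nonneg hgγ)] at h1
  have h2 : |f a| ≠ 0 := abs_ne_zero.2 hfa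
  have h3 : |g γ| ≠ 0 := abs_ne_zero.2 hgγ
  apply hne
  have h4 : α * (|f a| * |g γ|) = β * (|f a| * |g γ|) := by linarith
  exact mul_right_cancel₀ (mul_ne_zero h2 h3) h4

/-- The edge function of one factor placed in one layer of the product. -/
noncomputable def layer (w : Sym2 V → ℝ) (γ : W) : Sym2 (V × W) → ℝ :=
  open Classical in
  Sym2.lift ⟨fun p q => if p.2 = γ ∧ q.2 = γ then w s(p.1, q.1) else 0, fun p q =>
    if_congr and_comm (by rw [Sym2.eq_swap]) rfl⟩

/-- For `-2` all vertex sums vanish, and they still do after extension by zero to the whole product.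
-/
theorem IsEdgeEig.layer {w : Sym2 V → ℝ} (h : IsEdgeEig X (-2) w) (γ : W) :
    IsEdgeEig (X.boxProd Y) (-2) (layer w γ) := by
  classical
  have hs : ∀ s, s ∉ (X.boxProd Y).edgeSet → LineGraphPST.layer w γ s = 0 := by
    intro s hs
    induction s using Sym2.ind with
    | _ p q =>
      obtain ⟨p, γ₁⟩ := p
      obtain ⟨q, γ₂⟩ := q
      simp only [LineGraphPST.layer, Sym2.lift_mk]
      split_ifs with h1
      · obtain ⟨rfl, rfl⟩ := h1
        exact h.supp _ fun h2 => hs (by simpa using h2)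
      · rfl
  have h0 : ∀ v, vertexSum (LineGraphPST.layer w γ) v = 0 := by
    rintro ⟨c, γ'⟩
    rw [vertexSum_boxProd hs]
    simp only [LineGraphPST.layer, Sym2.lift_mk, and_self]
    have h1 : w s(c, c) = 0 := h.supp _ (by simp)
    have h2 := h.vertexSum_eq_zero c
    rw [vertexSum] at h2
    by_cases h3 : γ' = γ
    · simp [h3, h2, h1]
    · simp [h3]
  exact ⟨hs, fun p q _ => by rw [h0, h0]; ring⟩

theorem EdgeParallel.neg_two_notMem
    (h : EdgeParallel (X.boxProd Y) s((a, γ), (b, γ)) s((a, δ), (b, δ))) (hγδ : γ ≠ δ) :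
    (-2 : ℝ) ∉ edgeSupport X s(a, b) := by
  rintro ⟨w, hw, h0⟩
  have := h _ _ (hw.layer γ)
  simp [layer, hγδ.symm, h0] at this

/-- By `EdgeParallel.eq_of_adj` in both directions, `γ` and `δ` are each other's only neighbours, so
no walk leaves them. -/
theorem EdgeParallel.exhaust (hY : Y.Connected)
    (h : EdgeParallel (X.boxProd Y) s((a, γ), (b, γ)) s((a, δ), (b, δ)))
    (hab : X.Adj a b) (hγδ : Y.Adj γ δ) (w : W) : w = γ ∨ w = δ := by
  have hne : s((a, γ), (b, γ)) ≠ s((a, δ), (b, δ)) := by simp [hγδ.ne]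
  have h1 : ∀ w, Y.Adj γ w → w = δ := fun w hw => h.eq_of_adj hne hab hγδ hw
  have h2 : ∀ w, Y.Adj δ w → w = γ := fun w hw => h.symm.eq_of_adj hne.symm hab hγδ.symm hw
  have h3 : ∀ u w, Y.Walk u w → (u = γ ∨ u = δ) → (w = γ ∨ w = δ) := by
    intro u w p
    induction p with
    | nil => exact id
    | cons hadj _ ih =>
      rintro (rfl | rfl)
      · exact ih (Or.inr (h1 _ hadj))
      · exact ih (Or.inl (h2 _ hadj))
  obtain ⟨p⟩ := hY.preconnected γ w
  exact h3 _ _ p (Or.inl rfl)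

/-- The signless Laplacian of `K₂` is the all-ones matrix; `t = 1` and `t = -1` give its symmetric
and antisymmetric eigenvectors, for 2 and 0. -/
theorem isSignlessEig_of_exhaust (hγδ : Y.Adj γ δ) (hW : ∀ w, w = γ ∨ w = δ) {t : ℝ}
    (ht : t * t = 1) : ∃ g, IsSignlessEig Y (1 + t) g ∧ g γ = 1 ∧ g δ = t := by
  classical
  have hne := hγδ.ne
  refine ⟨fun w => if w = γ then 1 else t, fun w => ?_, if_pos rfl, if_neg hne.symm⟩
  rcases hW w with rfl | rfl
  · rw [Finset.sum_eq_single δ]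
    · simp [hγδ, hne.symm]
    · intro u _ hu
      exact if_neg fun hu' => hu ((hW u).resolve_left hu'.ne.symm)
    · simp
  · rw [Finset.sum_eq_single γ]
    · simp [hγδ.symm, hne.symm]
      linarith
    · intro u _ hu
      exact if_neg fun hu' => hu ((hW u).resolve_right hu'.ne.symm)
    · simp

theorem EdgePST.exists_eq_four_mul
    (h : EdgePST (X.boxProd Y) s((a, γ), (b, γ)) s((a, δ), (b, δ)))
    (hab : X.Adj a b) (hγδ : Y.Adj γ δ) (hW : ∀ w, w = γ ∨ w = δ) {θ : ℝ}
    (hθ : θ ∈ edgeSupport X s(a, b)) : ∃ k : ℤ, θ = 4 * k := by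
  have hθ2 : θ + 2 ≠ 0 := by
    intro h0
    refine h.edgeParallel.neg_two_notMem hγδ.ne ?_
    rwa [← eq_neg_of_add_eq_zero_left h0]
  have hint := isIntegral_of_mem_edgeSupport hθ
  obtain ⟨ζ, hζ, h0⟩ := hθ
  obtain ⟨τ, -, η, -, h⟩ := h
  have hc : vertexSum ζ a + vertexSum ζ b ≠ 0 := by
    rw [hζ.eig a b hab]
    exact mul_ne_zero hθ2 h0
  -- The edge function of `Nζ ⊗ (1, t)` has eigenvalue `θ + 1 + t` and takes values in the ratio `1
  -- : t` on the two edges, not zero by `hc`.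
  have key : ∀ t : ℝ, t * t = 1 → Complex.exp (-(Complex.I * τ * (θ + 1 + t))) = η * t := by
    intro t ht
    obtain ⟨g, hg, hg1, hg2⟩ := isSignlessEig_of_exhaust hγδ hW ht
    have h1 := h _ _ (hζ.isSignlessEig.boxProd hg).isEdgeEig
    rw [edgeOf_of_adj _ (by simpa using hab), edgeOf_of_adj _ (by simpa using hab)] at h1
    simp only [← add_mul, hg1, hg2, mul_one] at h1
    have hc' : ((vertexSum ζ a + vertexSum ζ b : ℝ) : ℂ) ≠ 0 := by exact_mod_cast hc
    refine mul_right_cancel₀ hc' ?_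
    rw [show (θ : ℂ) + 1 + t = ((θ + 2 + (1 + t) - 2 : ℝ) : ℂ) by push_cast; ring, h1]
    push_cast
    ring
  have hE : Complex.exp (-(Complex.I * τ * θ)) = -η := by
    have := key (-1) (by norm_num)
    push_cast at this
    rw [show (θ : ℂ) + 1 + -1 = θ by ring] at this
    rw [this]
    ring
  have hEF : Complex.exp (-(Complex.I * τ * (θ + 2))) = η := by
    have := key 1 (by norm_num)
    push_cast at this
    rw [show (θ : ℂ) + 1 + 1 = θ + 2 by ring] at this
    rw [this]
    ring
  have hF : Complex.exp (2 * τ * Complex.I) = η := by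
    have h1 := h _ _ (isEdgeEig_fourCycle hab hγδ)
    have h2 : fourCycle a b γ δ s((a, δ), (b, δ)) = 1 := by
      simp [fourCycle, edgeIndicator, hab.ne, hab.ne.symm, hγδ.ne.symm]
    rw [fourCycle_left hab.ne hγδ.ne, h2] at h1
    push_cast at h1
    rw [mul_one, mul_one] at h1
    rw [← h1]
    ring_nf
  have hη0 : η ≠ 0 := hF ▸ Complex.exp_ne_zero _
  -- The eigenvalues `θ`, `θ + 2` and `-2` give the phases `-η`, `η` and `η`, whence `η² = -η`.
  have hη : η = -1 := by
    have h1 : Complex.exp (-(Complex.I * τ * (θ + 2))) * Complex.exp (2 * τ * Complex.I) =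
        Complex.exp (-(Complex.I * τ * θ)) := by
      rw [← Complex.exp_add]
      ring_nf
    rw [hE, hEF, hF] at h1
    refine mul_right_cancel₀ hη0 ?_
    rw [h1]
    ring
  rw [hη, neg_neg] at hE
  rw [hη, ← Complex.exp_pi_mul_I] at hF
  obtain ⟨m, hm⟩ := Complex.exp_eq_exp_iff_exists_int.1 hF
  obtain ⟨k, hk⟩ := Complex.exp_eq_one_iff.1 hE
  have hm' : 2 * τ = Real.pi * (2 * m + 1) := by
    have h1 : (2 * τ : ℂ) = Real.pi * (2 * m + 1) := by
      refine mul_right_cancel₀ Complex.I_ne_zero ?_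
      rw [hm]
      ring
    exact_mod_cast h1
  have hk' : τ * θ = -(k * (2 * Real.pi)) := by
    have h1 : (τ * θ : ℂ) = -(k * (2 * Real.pi)) := by
      refine mul_right_cancel₀ Complex.I_ne_zero ?_
      linear_combination -hk
    exact_mod_cast h1
  -- Now `2τ` is an odd multiple of `π` and `τθ` a multiple of `2π`; eliminating `τ` makes `θ` an
  -- odd fraction of a multiple of four.
  refine LineGraphPST.exists_eq_four_mul hint (k := -k) (m := m) ?_
  refine mul_left_cancel₀ Real.pi_ne_zero ?_
  push_cast
  linear_combination (-θ) * hm' + 2 * hk'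

/-! ### Sufficiency: the two layers of a prism -/

theorem vertexSum_of_exhaust {ζ : Sym2 (V × W) → ℝ}
    (h : ∀ s, s ∉ (X.boxProd Y).edgeSet → ζ s = 0) (hW : ∀ w, w = γ ∨ w = δ) (c : V) :
    vertexSum ζ (c, γ) =
      vertexSum (fun s => ζ (s.map fun v => (v, γ))) c + ζ s((c, γ), (c, δ)) := by
  rw [vertexSum_boxProd h, Finset.sum_eq_single δ]
  · rfl
  · intro u _ hu
    rw [(hW u).resolve_right hu]
    exact h _ (by simp)
  · simp

theorem IsEdgeEig.map_layer_eq_zero {θ : ℝ} {ζ : Sym2 (V × W) → ℝ}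
    (h : IsEdgeEig (X.boxProd Y) θ ζ) (γ : W) {s : Sym2 V} (hs : s ∉ X.edgeSet) :
    ζ (s.map fun v => (v, γ)) = 0 := by
  refine h.supp _ fun h1 => hs ?_
  induction s using Sym2.ind with
  | _ a b => simpa using h1

/-- The difference of the two layers of an edge eigenfunction. -/
theorem IsEdgeEig.layer_sub {θ : ℝ} {ζ : Sym2 (V × W) → ℝ} (h : IsEdgeEig (X.boxProd Y) θ ζ)
    (hW : ∀ w, w = γ ∨ w = δ) :
    IsEdgeEig X θ (fun s => ζ (s.map fun v => (v, γ)) - ζ (s.map fun v => (v, δ))) := by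
  -- The edge joining the two copies of `c` contributes equally to both layers and cancels.
  have h1 : ∀ c, vertexSum (fun s => ζ (s.map fun v => (v, γ)) - ζ (s.map fun v => (v, δ))) c =
      vertexSum ζ (c, γ) - vertexSum ζ (c, δ) := by
    intro c
    rw [vertexSum_of_exhaust h.supp hW, vertexSum_of_exhaust h.supp
      (fun w => (hW w).symm), Sym2.eq_swap (a := (c, δ))]
    simp only [vertexSum, Finset.sum_sub_distrib]
    ring
  refine ⟨fun s hs => ?_, fun c d hcd => ?_⟩
  · simp only [h.map_layer_eq_zero _ hs, sub_zero]
  · have h2 := h.eig (c, γ) (d, γ) (by simpa using hcd)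
    have h3 := h.eig (c, δ) (d, δ) (by simpa using hcd)
    rw [h1, h1]
    simp only [Sym2.map_mk]
    linarith

/-- The sum of the two layers of an edge eigenfunction. -/
theorem IsEdgeEig.layer_add {θ : ℝ} {ζ : Sym2 (V × W) → ℝ} (h : IsEdgeEig (X.boxProd Y) θ ζ)
    (hθ : θ ≠ -2) (hγδ : Y.Adj γ δ) (hW : ∀ w, w = γ ∨ w = δ) :
    IsEdgeEig X (θ - 2) (fun s => ζ (s.map fun v => (v, γ)) + ζ (s.map fun v => (v, δ))) := by
  have h1 : ∀ c, vertexSum (fun s => ζ (s.map fun v => (v, γ)) + ζ (s.map fun v => (v, δ))) c =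
      vertexSum ζ (c, γ) + vertexSum ζ (c, δ) - 2 * ζ s((c, γ), (c, δ)) := by
    intro c
    rw [vertexSum_of_exhaust h.supp hW, vertexSum_of_exhaust h.supp
      (fun w => (hW w).symm), Sym2.eq_swap (a := (c, δ))]
    simp only [vertexSum, Finset.sum_add_distrib]
    ring
  refine ⟨fun s hs => ?_, fun c d hcd => ?_⟩
  · simp only [h.map_layer_eq_zero _ hs, add_zero]
  · have h2 := h.eig (c, γ) (d, γ) (by simpa using hcd)
    have h3 := h.eig (c, δ) (d, δ) (by simpa using hcd)
    have h4 := h.eig (c, γ) (c, δ) (by simpa using hγδ)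
    have h5 := h.eig (d, γ) (d, δ) (by simpa using hγδ)
    rw [h1, h1]
    simp only [Sym2.map_mk]
    -- If `S` is the total of the four vertex sums, the joining edges at `c` and `d` add up to `S /
    -- (θ + 2)`, and the factor `1 - 2 / (θ + 2) = θ / (θ + 2)` lowers the eigenvalue by 2.
    have h6 : θ + 2 ≠ 0 := fun h7 => hθ (eq_neg_of_add_eq_zero_left h7)
    refine mul_left_cancel₀ h6 ?_
    linear_combination θ * h2 + θ * h3 + 2 * h4 + 2 * h5

/-- The eigenvalue support of a layer edge of a prism. -/
theorem mem_edgeSupport_prism {θ : ℝ} (hγδ : Y.Adj γ δ) (hW : ∀ w, w = γ ∨ w = δ)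
    (hθ : θ ∈ edgeSupport (X.boxProd Y) s((a, γ), (b, γ))) :
    θ = -2 ∨ θ ∈ edgeSupport X s(a, b) ∨ θ - 2 ∈ edgeSupport X s(a, b) := by
  obtain ⟨ζ, hζ, h0⟩ := hθ
  by_contra! hcon
  obtain ⟨h1, h2, h3⟩ := hcon
  have h4 : ζ s((a, γ), (b, γ)) - ζ s((a, δ), (b, δ)) = 0 := by
    by_contra h5
    exact h2 ⟨_, hζ.layer_sub hW, h5⟩
  have h6 : ζ s((a, γ), (b, γ)) + ζ s((a, δ), (b, δ)) = 0 := by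
    by_contra h5
    exact h3 ⟨_, hζ.layer_add h1 hγδ hW, h5⟩
  exact h0 (by linarith)

/-- At `τ = π/2` the phase is 1 on `4ℤ` and `-1` on `4ℤ + 2`. Antisymmetric values on the two edges
occur only for `θ` in `4ℤ`, non-zero symmetric ones only for `θ` in `4ℤ + 2`, which also contains
`-2`. -/
theorem edgePST_prism (hγδ : Y.Adj γ δ) (hW : ∀ w, w = γ ∨ w = δ)
    (h : ∀ θ ∈ edgeSupport X s(a, b), ∃ k : ℤ, θ = 4 * k) :
    EdgePST (X.boxProd Y) s((a, γ), (b, γ)) s((a, δ), (b, δ)) := by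
  refine ⟨Real.pi / 2, by positivity, -1, by simp, fun θ ζ hζ => ?_⟩
  by_cases h1 : ζ s((a, γ), (b, γ)) = ζ s((a, δ), (b, δ))
  · rw [h1]
    by_cases h0 : ζ s((a, δ), (b, δ)) = 0
    · simp [h0]
    have hk : ∃ k : ℤ, θ = 4 * k + 2 := by
      by_cases h2 : θ = -2
      · exact ⟨-1, by rw [h2]; norm_num⟩
      · obtain ⟨k, hk⟩ := h (θ - 2) ⟨_, hζ.layer_add h2 hγδ hW, by
          simp only [Sym2.map_mk, h1]
          rw [← two_mul]
          exact mul_ne_zero two_ne_zero h0⟩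
        exact ⟨k, by linarith⟩
    obtain ⟨k, rfl⟩ := hk
    congr 1
    rw [← Complex.exp_pi_mul_I, Complex.exp_eq_exp_iff_exists_int]
    refine ⟨-k - 1, ?_⟩
    push_cast
    ring
  · have h0 := sub_ne_zero.2 h1
    obtain ⟨k, hk⟩ := h θ ⟨_, hζ.layer_sub hW, h0⟩
    -- A non-zero sum would put `θ - 2` in `4ℤ` along with `θ`.
    have h2 : ζ s((a, γ), (b, γ)) + ζ s((a, δ), (b, δ)) = 0 := by
      by_contra h3
      have h4 : θ ≠ -2 := by
        intro h5
        have h6 : 2 * k = (-1 : ℤ) := by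
          have : 2 * (k : ℝ) = -1 := by linarith
          exact_mod_cast this
        omega
      obtain ⟨j, hj⟩ := h (θ - 2) ⟨_, hζ.layer_add h4 hγδ hW, h3⟩
      have h6 : 2 * k - 2 * j = (1 : ℤ) := by
        have : 2 * (k : ℝ) - 2 * j = 1 := by linarith
        exact_mod_cast this
      omega
    rw [eq_neg_of_add_eq_zero_right h2, hk]
    have h3 : Complex.exp (-(Complex.I * ((Real.pi / 2 : ℝ) : ℂ) * ((4 * k : ℝ) : ℂ))) = 1 := by
      rw [Complex.exp_eq_one_iff]
      refine ⟨-k, ?_⟩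
      push_cast
      ring
    rw [h3]
    push_cast
    ring

end FourCycle

/-! ### Copies of `K₂` and assembly of the equivalence -/

theorem isK2_of_exhaust {W : Type*} {Y : SimpleGraph W} {γ δ : W} (hγδ : Y.Adj γ δ)
    (hW : ∀ w, w = γ ∨ w = δ) : IsK2 Y := by
  classical
  have hne := hγδ.ne
  let f : W → Fin 2 := fun w => if w = γ then 0 else 1
  have hfγ : f γ = 0 := if_pos rfl
  have hfδ : f δ = 1 := if_neg hne.symm
  have hbij : Function.Bijective f := by
    constructor
    · intro u w h
      rcases hW u with rfl | rfl <;> rcases hW w with rfl | rfl <;> simp_all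
    · intro i
      fin_cases i
      · exact ⟨γ, hfγ⟩
      · exact ⟨δ, hfδ⟩
  refine ⟨⟨Equiv.ofBijective f hbij, ?_⟩⟩
  intro u w
  rw [SimpleGraph.top_adj, Equiv.ofBijective_apply, Equiv.ofBijective_apply,
    hbij.1.ne_iff]
  refine ⟨fun h => ?_, fun h => h.ne⟩
  rcases hW u with rfl | rfl <;> rcases hW w with rfl | rfl
  · exact absurd rfl h
  · exact hγδ
  · exact hγδ.symm
  · exact absurd rfl h

theorem IsK2.adj_and_exhaust {W : Type*} {Y : SimpleGraph W} (h : IsK2 Y) {γ δ : W}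
    (hne : γ ≠ δ) : Y.Adj γ δ ∧ ∀ w, w = γ ∨ w = δ := by
  obtain ⟨φ⟩ := h
  have hne' : φ γ ≠ φ δ := fun h => hne (φ.injective h)
  refine ⟨φ.map_adj_iff.1 (by simpa using hne'), fun w => ?_⟩
  have : φ w = φ γ ∨ φ w = φ δ := by omega
  exact this.imp (fun h => φ.injective h) fun h => φ.injective h

section

variable {V W T : Type*} [Fintype V] [Fintype W] [Fintype T] {X : SimpleGraph V}
  {Y : SimpleGraph W} {Z : SimpleGraph T}

/-- State transfer from a layer edge of a product takes place in a prism, to the parallel edge. -/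
theorem EdgePST.exists_parallel [Nontrivial W] (hY : Y.Connected) {a b : V} {γ : W}
    {s₂ : Sym2 (V × W)} (h : EdgePST (X.boxProd Y) s((a, γ), (b, γ)) s₂)
    (hne : s((a, γ), (b, γ)) ≠ s₂) (hab : X.Adj a b) :
    ∃ δ, Y.Adj γ δ ∧ (∀ w, w = γ ∨ w = δ) ∧ s₂ = s((a, δ), (b, δ)) := by
  obtain ⟨δ, hγδ⟩ := hY.preconnected.exists_adj_of_nontrivial γ
  have hp := h.edgeParallel
  rcases hp.cases hne hab hγδ with rfl | rfl | rfl
  · exact ⟨δ, hγδ, hp.exhaust hY hab hγδ, rfl⟩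
  · exact (hp.not_corner hab hγδ).elim
  -- The corner at `b` becomes the corner at `a` after exchanging the two ends.
  · rw [Sym2.eq_swap] at hp
    exact (hp.not_corner hab.symm hγδ).elim

/-- The isomorphism `φ` covers both orders of the factors: it is the identity for edges along the
first factor and `SimpleGraph.boxProdComm` for the others. -/
theorem pstConditions_of_hasVertexPST [Nontrivial W] (hX : X.Connected) (hY : Y.Connected)
    [Fintype X.edgeSet] [Fintype Z.edgeSet] (φ : X.boxProd Y ≃g Z) {ε₁ ε₂ : Z.edgeSet}
    (hε : ε₁ ≠ ε₂) {a b : V} {γ : W} (hab : X.Adj a b)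
    (hε₁ : (ε₁ : Sym2 T) = s(φ (a, γ), φ (b, γ))) (h : HasVertexPST Z.lineGraph ε₁ ε₂) :
    PSTConditions X Y Z (fun e γ => e.map fun v => φ (v, γ)) ε₁ ε₂ := by
  rw [hasVertexPST_lineGraph_iff] at h
  have hinv : ∀ s : Sym2 T, (s.map φ.symm).map φ = s := by
    intro s
    induction s using Sym2.ind with
    | _ p q => simp
  have h' := h.map_iso φ.symm
  have h1 : (ε₁ : Sym2 T).map φ.symm = s((a, γ), (b, γ)) := by simp [hε₁]
  rw [h1] at h'
  obtain ⟨δ, hγδ, hW, h2⟩ := h'.exists_parallel hY (by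
    intro h3
    rw [← h1] at h3
    apply hε
    apply Subtype.ext
    rw [← hinv ε₁, h3, hinv]) hab
  rw [h2] at h'
  have h4 : ∀ θ ∈ edgeSupport X s(a, b), ∃ k : ℤ, θ = 4 * k :=
    fun θ hθ => h'.exists_eq_four_mul hab hγδ hW hθ
  have h5 : (-2 : ℝ) ∉ edgeSupport X s(a, b) := h'.edgeParallel.neg_two_notMem hγδ.ne
  refine ⟨isK2_of_exhaust hγδ hW, Or.inl ⟨s(a, b), hab, ?_⟩, ⟨s(a, b), hab⟩, γ, δ, hγδ.ne,
    hε₁, ?_, ?_, ?_, ?_⟩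
  -- A multiple of four that is at least `-2` is non-negative.
  · refine isBridge_of_edgeSupport_nonneg hX hab fun θ hθ => ?_
    obtain ⟨k, rfl⟩ := h4 θ hθ
    obtain ⟨ζ, hζ, h0⟩ := hθ
    have h6 := hζ.neg_two_le h0
    have h7 : -2 ≤ 4 * k := by exact_mod_cast h6
    have h8 : 0 ≤ k := by omega
    positivity
  · rw [← hinv ε₂, h2]
    rfl
  · rwa [eigenvalueSupport_lineGraph]
  · intro θ hθ
    rw [eigenvalueSupport_lineGraph] at hθ
    have h6 := edgeSupport_map_subset φ s((a, γ), (b, γ)) (by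
      rw [← h1, hinv]; exact hθ)
    rcases mem_edgeSupport_prism hγδ hW h6 with h7 | h7 | h7
    · exact ⟨-2, by rw [h7]; norm_num⟩
    · obtain ⟨k, hk⟩ := h4 _ h7
      exact ⟨4 * k, by rw [hk]; push_cast; rfl⟩
    · obtain ⟨k, hk⟩ := h4 _ h7
      exact ⟨4 * k + 2, by push_cast; linarith⟩
  · rw [eigenvalueSupport_lineGraph]
    exact h4

theorem hasVertexPST_of_pstConditions [Fintype X.edgeSet] [Fintype Z.edgeSet]
    (φ : X.boxProd Y ≃g Z) {ε₁ ε₂ : Z.edgeSet}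
    (h : PSTConditions X Y Z (fun e γ => e.map fun v => φ (v, γ)) ε₁ ε₂) :
    HasVertexPST Z.lineGraph ε₁ ε₂ := by
  obtain ⟨hK, -, e, γ, δ, hne, h1, h2, -, -, h4⟩ := h
  obtain ⟨hγδ, hW⟩ := IsK2.adj_and_exhaust hK hne
  rw [hasVertexPST_lineGraph_iff, h1, h2]
  rw [eigenvalueSupport_lineGraph] at h4
  obtain ⟨s, hs⟩ := e
  induction s using Sym2.ind with
  | _ a b => exact (edgePST_prism hγδ hW h4).map_iso φ

end

end LineGraphPST

theorem mainTheorem4 {V W : Type*} [Fintype V] [Fintype W] [Nontrivial V] [Nontrivial W]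
    (X₁ : SimpleGraph V) (X₂ : SimpleGraph W) (hX₁ : X₁.Connected) (hX₂ : X₂.Connected)
    [Fintype X₁.edgeSet] [Fintype X₂.edgeSet] [Fintype (X₁.boxProd X₂).edgeSet]
    (ε₁ ε₂ : (X₁.boxProd X₂).edgeSet) (hε : ε₁ ≠ ε₂) :
    HasVertexPST (X₁.boxProd X₂).lineGraph ε₁ ε₂ ↔
      (PSTConditions X₁ X₂ (X₁.boxProd X₂) (fun e γ => e.map (fun v => (v, γ))) ε₁ ε₂ ∨
       PSTConditions X₂ X₁ (X₁.boxProd X₂) (fun e c => e.map (fun w => (c, w))) ε₁ ε₂) := by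
  constructor
  · intro h
    obtain ⟨s, hs⟩ := ε₁
    induction s using Sym2.ind with
    | _ p q =>
      obtain ⟨a, γ⟩ := p
      obtain ⟨b, δ⟩ := q
      have hadj : (X₁.boxProd X₂).Adj (a, γ) (b, δ) := hs
      rw [SimpleGraph.boxProd_adj] at hadj
      rcases hadj with ⟨hab, rfl⟩ | ⟨hγδ, rfl⟩
      · exact Or.inl (LineGraphPST.pstConditions_of_hasVertexPST hX₁ hX₂ SimpleGraph.Iso.refl hε
          hab rfl h)
      · exact Or.inr (LineGraphPST.pstConditions_of_hasVertexPST hX₂ hX₁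
          (SimpleGraph.boxProdComm X₂ X₁) hε hγδ rfl h)
  · rintro (h | h)
    · exact LineGraphPST.hasVertexPST_of_pstConditions SimpleGraph.Iso.refl h
    · exact LineGraphPST.hasVertexPST_of_pstConditions (SimpleGraph.boxProdComm X₂ X₁) h
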